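/- Let $K$ be a number of descriptions, let $X$ be a real random variable with finite variance (arbitrarily distributed otherwise), and let $Z$ be a random variable with values in an arbitrary measurable space, arbitrarily jointly distributed with $X$. Let $N_0,\dots,N_{K-1}$ be i.i.d. standard Gaussian $\mathcal N(0,1)$ random variables such that $(X,Z)$ is independent of $(N_0,\dots,N_{K-1})$, and for $\gamma>0$ put $Y_i=\sqrt{\gamma}\,X+N_i$, $i=0,\dots,K-1$. Let $$I(X;Y_0,\dots,Y_{K-1}\mid Z)=\mathbb E_Z\big[D\big(P_{X,Y_0,\dots,Y_{K-1}|Z}\,\big\|\,P_{X|Z}\times P_{Y_0,\dots,Y_{K-1}|Z}\big)\big]$$ denote the conditional mutual information in bits (the relative entropy $D$ is taken with $\log_2$), and let $\mathrm{var}(X|Z)=\mathbb E_Z[\mathrm{var}(X|Z=z)]=\mathbb E\big[(X-\mathbb E[X|Z])^2\big]$. Then $$\lim_{\gamma\downarrow 0}\frac1\gamma\, I(X;Y_0,\dots,Y_{K-1}\mid Z)=\frac{K\log_2 e}{2}\,\mathrm{var}(X|Z).$$ -/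

import Mathlib

open MeasureTheory ProbabilityTheory InformationTheory Filter Topology
open scoped ENNReal

/-- Conditional mutual information `I(U; V | Z)` in bits:
`E_Z [ D( P_{U,V|Z} ‖ P_{U|Z} × P_{V|Z} ) ]`, where `P_{·|Z}` are regular conditional distributions.
Mathlib's `klDiv` uses the natural logarithm, hence the division by `log 2`. -/
noncomputable def condMutualInfo {Ω A B C : Type*} [MeasurableSpace Ω]
    [MeasurableSpace A] [StandardBorelSpace A] [Nonempty A]
    [MeasurableSpace B] [StandardBorelSpace B] [Nonempty B] [MeasurableSpace C]
    (μ : Measure Ω) [IsFiniteMeasure μ] (U : Ω → A) (V : Ω → B) (Z : Ω → C) : ℝ≥0∞ :=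
  (∫⁻ z, klDiv (condDistrib (fun ω => (U ω, V ω)) Z μ z)
      ((condDistrib U Z μ z).prod (condDistrib V Z μ z)) ∂(μ.map Z)) / ENNReal.ofReal (Real.log 2)

/-- The averaged conditional variance `var(X|Z) = E_Z [ var(X | Z = z) ]`, a real number. -/
noncomputable def avgCondVar {Ω C : Type*} [MeasurableSpace Ω] [MeasurableSpace C]
    (μ : Measure Ω) (X : Ω → ℝ) (Z : Ω → C) : ℝ :=
  ∫ ω, condVar (MeasurableSpace.comap Z inferInstance) X μ ω ∂μ

open scoped NNReal

/-! Conditioning on `Z = z` reduces the claim to one Gaussian channel with input law ν, the regular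
conditional law of X, and gain ε = √γ. Relative to ν times the standard Gaussian, the joint law has
density exp(εxS - Kε²x²/2), which depends on y only through S = Σ yᵢ, of law N(0, K). So the
information is a double integral over s and x (`gaussianInfo`, `klDiv_gaussianChannel`), with v = K.

Upper bound: the output density is the best reference, so replacing it by the tilt at the mean m of
ν can only increase the integral, and the divergence between shifted Gaussians then gives (v/2) ε²
var ν for every ε (`gaussianInfo_le`). Lower bound: divided by ε², the integrand tends pointwise to
(s(x - m))²/2, whose integral is (v/2) var ν, and Fatou applies (`le_liminf_gaussianInfo`). A finite
second moment is all that is needed.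

The upper bound, uniform in ε, also dominates the integral over z, so the limit passes through it
(`tendsto_lintegral_gaussianInfo`). -/

/-! ### Gaussian tilts, their mixtures, and pointwise divergence -/

/-- The density at `s` of `gaussianReal (v * c) v` with respect to `gaussianReal 0 v`. -/
noncomputable def gaussianTilt (v : ℝ≥0) (c s : ℝ) : ℝ := Real.exp (c * s - v * c ^ 2 / 2)

/-- The average of `gaussianTilt v (ε * x) s` over `x`. -/
noncomputable def gaussianTiltMix (v : ℝ≥0) (ν : Measure ℝ) (ε s : ℝ) : ℝ :=
  ∫ x, gaussianTilt v (ε * x) s ∂ν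

/-- The perspective of `klFun`: pointwise contribution of two densities to the relative entropy. -/
noncomputable def klPersp (p r : ℝ) : ℝ := r * klFun (p / r)

lemma klPersp_nonneg {p r : ℝ} (hp : 0 ≤ p) (hr : 0 ≤ r) : 0 ≤ klPersp p r :=
  mul_nonneg hr (klFun_nonneg (div_nonneg hp hr))

/-- Isolates the dependence on `r`: the cross term is linear in `p`, so averaging over `p` involves
`r` only through the mean. -/
lemma klPersp_eq {p r : ℝ} (hp : 0 < p) (hr : 0 < r) :
    klPersp p r = klFun p - p * Real.log r + (r - 1) := by
  rw [klPersp, klFun_apply, klFun_apply, Real.log_div hp.ne' hr.ne']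
  field_simp
  ring

lemma measurable_klPersp : Measurable (fun q : ℝ × ℝ => klPersp q.1 q.2) := by
  unfold klPersp
  exact measurable_snd.mul (measurable_klFun.comp (measurable_fst.div measurable_snd))

lemma gaussianTilt_pos (v : ℝ≥0) (c s : ℝ) : 0 < gaussianTilt v c s := Real.exp_pos _

lemma continuous_gaussianTilt (v : ℝ≥0) :
    Continuous (fun q : ℝ × ℝ => gaussianTilt v q.1 q.2) := by
  unfold gaussianTilt; fun_prop

/-- Completing the square in `c` gives a bound uniform in `c`, so for fixed `s` everything is
bounded in `x` whatever the tails of ν. For `v = 0` the quotient is 0 by convention, and `s = 0` is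
needed; this case occurs when there are no observations. -/
lemma gaussianTilt_le {v : ℝ≥0} {s : ℝ} (h : v = 0 → s = 0) (c : ℝ) :
    gaussianTilt v c s ≤ Real.exp (s ^ 2 / (2 * v)) := by
  refine Real.exp_le_exp.2 ?_
  rcases eq_or_ne v 0 with hv | hv
  · simp [hv, h hv]
  · have hv' : (0 : ℝ) < v := by positivity
    rw [le_div_iff₀ (by positivity)]
    nlinarith [sq_nonneg (s - v * c)]

lemma continuous_gaussianTilt_left (v : ℝ≥0) (ε s : ℝ) :
    Continuous (fun x => gaussianTilt v (ε * x) s) := by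
  unfold gaussianTilt; fun_prop

lemma integrable_gaussianTilt_left {v : ℝ≥0} {s : ℝ} (h : v = 0 → s = 0)
    (ν : Measure ℝ) [IsFiniteMeasure ν] (ε : ℝ) :
    Integrable (fun x => gaussianTilt v (ε * x) s) ν := by
  refine Integrable.of_bound (continuous_gaussianTilt_left v ε s).aestronglyMeasurable
    (Real.exp (s ^ 2 / (2 * v))) (ae_of_all _ fun x => ?_)
  rw [Real.norm_of_nonneg (gaussianTilt_pos _ _ _).le]
  exact gaussianTilt_le h _

lemma integrable_klFun_gaussianTilt_left {v : ℝ≥0} {s : ℝ} (h : v = 0 → s = 0)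
    (ν : Measure ℝ) [IsFiniteMeasure ν] (ε : ℝ) :
    Integrable (fun x => klFun (gaussianTilt v (ε * x) s)) ν := by
  obtain ⟨M, hM⟩ := (isCompact_Icc (a := (0 : ℝ)) (b := Real.exp (s ^ 2 / (2 * v)))).exists_bound_of_continuousOn
    continuous_klFun.continuousOn
  exact Integrable.of_bound
    (continuous_klFun.comp (continuous_gaussianTilt_left v ε s)).aestronglyMeasurable
    M (ae_of_all _ fun x => hM _ ⟨(gaussianTilt_pos _ _ _).le, gaussianTilt_le h _⟩)

lemma gaussianTiltMix_pos {v : ℝ≥0} {s : ℝ} (h : v = 0 → s = 0)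
    (ν : Measure ℝ) [IsProbabilityMeasure ν] (ε : ℝ) : 0 < gaussianTiltMix v ν ε s := by
  refine (integral_pos_iff_support_of_nonneg (fun x => (gaussianTilt_pos _ _ _).le)
    (integrable_gaussianTilt_left h ν ε)).2 ?_
  have : Function.support (fun x => gaussianTilt v (ε * x) s) = Set.univ := by
    ext x; simp [(gaussianTilt_pos v (ε * x) s).ne']
  simp [this]

/-- Among all reference values, the mean of the densities minimizes the average divergence. -/
lemma lintegral_klPersp_gaussianTiltMix_le {v : ℝ≥0} {s : ℝ} (h : v = 0 → s = 0)
    (ν : Measure ℝ) [IsProbabilityMeasure ν] (ε : ℝ) {q : ℝ} (hq : 0 < q) :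
    ∫⁻ x, ENNReal.ofReal (klPersp (gaussianTilt v (ε * x) s) (gaussianTiltMix v ν ε s)) ∂ν ≤
      ∫⁻ x, ENNReal.ofReal (klPersp (gaussianTilt v (ε * x) s) q) ∂ν := by
  have hm := gaussianTiltMix_pos h ν ε
  have h1 := integrable_gaussianTilt_left h ν ε
  have h2 := integrable_klFun_gaussianTilt_left h ν ε
  have hint : ∀ r : ℝ, 0 < r →
      Integrable (fun x => klPersp (gaussianTilt v (ε * x) s) r) ν ∧
      ∫ x, klPersp (gaussianTilt v (ε * x) s) r ∂ν =
        ∫ x, klFun (gaussianTilt v (ε * x) s) ∂ν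
          - gaussianTiltMix v ν ε s * Real.log r + (r - 1) := by
    intro r hr
    have e : (fun x => klPersp (gaussianTilt v (ε * x) s) r) = fun x =>
        klFun (gaussianTilt v (ε * x) s) - gaussianTilt v (ε * x) s * Real.log r + (r - 1) :=
      funext fun x => klPersp_eq (gaussianTilt_pos _ _ _) hr
    rw [e]
    have h3 : Integrable (fun x => klFun (gaussianTilt v (ε * x) s)
        - gaussianTilt v (ε * x) s * Real.log r) ν := h2.sub (h1.mul_const _)
    refine ⟨h3.add (integrable_const _), ?_⟩
    rw [integral_add h3 (integrable_const _),
      integral_sub h2 (h1.mul_const _), integral_mul_const]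
    simp [gaussianTiltMix]
  have hnn : ∀ r : ℝ, 0 < r → 0 ≤ᵐ[ν] fun x => klPersp (gaussianTilt v (ε * x) s) r :=
    fun r hr => ae_of_all _ fun x => klPersp_nonneg (gaussianTilt_pos _ _ _).le hr.le
  rw [← ofReal_integral_eq_lintegral_ofReal (hint _ hm).1 (hnn _ hm),
    ← ofReal_integral_eq_lintegral_ofReal (hint _ hq).1 (hnn _ hq), (hint _ hm).2, (hint _ hq).2]
  refine ENNReal.ofReal_le_ofReal ?_
  -- The gap between the two sides is exactly `klPersp` of the mixture against `q`.
  have := klPersp_nonneg hm.le hq.le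
  rw [klPersp_eq hm hq, klFun_apply] at this
  linarith

/-! ### Moments of a tilted Gaussian and divergence between shifts -/

lemma integrable_gaussianTilt_right (v : ℝ≥0) (c : ℝ) :
    Integrable (gaussianTilt v c) (gaussianReal 0 v) := by
  have := (integrable_exp_mul_gaussianReal (μ := 0) (v := v) c).mul_const (Real.exp (-(v * c ^ 2 / 2)))
  refine this.congr (ae_of_all _ fun s => ?_)
  simp only [gaussianTilt, ← Real.exp_add, sub_eq_add_neg]

lemma integral_gaussianTilt_right (v : ℝ≥0) (c : ℝ) :
    ∫ s, gaussianTilt v c s ∂gaussianReal 0 v = 1 := by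
  have h := congrFun (mgf_id_gaussianReal (μ := 0) (v := v)) c
  simp only [mgf, id] at h
  have e : ∀ s, gaussianTilt v c s = Real.exp (c * s) * Real.exp (-(v * c ^ 2 / 2)) := fun s => by
    simp only [gaussianTilt, ← Real.exp_add, sub_eq_add_neg]
  simp_rw [e]
  rw [integral_mul_const, h, ← Real.exp_add]
  simp

lemma integrable_mul_gaussianTilt_right (v : ℝ≥0) (c : ℝ) :
    Integrable (fun s => s * gaussianTilt v c s) (gaussianReal 0 v) := by
  have h : c ∈ interior (integrableExpSet id (gaussianReal 0 v)) := by
    simp [integrableExpSet_id_gaussianReal]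
  have := (integrable_pow_mul_exp_of_mem_interior_integrableExpSet h 1).mul_const
    (Real.exp (-(v * c ^ 2 / 2)))
  refine this.congr (ae_of_all _ fun s => ?_)
  simp only [gaussianTilt, sub_eq_add_neg, id, pow_one, Real.exp_add, mul_assoc]

lemma integral_mul_gaussianTilt_right (v : ℝ≥0) (c : ℝ) :
    ∫ s, s * gaussianTilt v c s ∂gaussianReal 0 v = v * c := by
  have h : c ∈ interior (integrableExpSet id (gaussianReal 0 v)) := by
    simp [integrableExpSet_id_gaussianReal]
  have h1 := hasDerivAt_mgf h
  rw [mgf_id_gaussianReal] at h1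
  have h2 : HasDerivAt (fun t : ℝ => Real.exp (0 * t + v * t ^ 2 / 2))
      (Real.exp (0 * c + v * c ^ 2 / 2) * (v * c)) c := by
    have : HasDerivAt (fun t : ℝ => 0 * t + v * t ^ 2 / 2) (v * c) c := by
      have := (((hasDerivAt_pow 2 c).const_mul (v : ℝ)).div_const 2)
      simp only [zero_mul, zero_add]
      exact this.congr_deriv (by push_cast; ring)
    exact this.exp
  -- The first moment comes from differentiating the moment generating function in two ways.
  have h3 := h1.unique h2
  have e : ∀ s, s * gaussianTilt v c s =
      s * Real.exp (c * s) * Real.exp (-(v * c ^ 2 / 2)) := fun s => by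
    simp only [gaussianTilt, sub_eq_add_neg, Real.exp_add, mul_assoc]
  simp_rw [e]
  simp only [id] at h3
  rw [integral_mul_const, h3, mul_right_comm, ← Real.exp_add]
  simp

/-- The relative entropy between two shifted Gaussians. -/
lemma lintegral_klPersp_gaussianTilt (v : ℝ≥0) (c d : ℝ) :
    ∫⁻ s, ENNReal.ofReal (klPersp (gaussianTilt v c s) (gaussianTilt v d s)) ∂gaussianReal 0 v =
      ENNReal.ofReal (v * (c - d) ^ 2 / 2) := by
  -- The log-ratio of two tilts is affine in `s`, so only total mass and first moment enter.
  have e : (fun s => klPersp (gaussianTilt v c s) (gaussianTilt v d s)) = fun s =>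
      (c - d) * (s * gaussianTilt v c s) - (v * (c ^ 2 - d ^ 2) / 2 + 1) * gaussianTilt v c s
        + gaussianTilt v d s := by
    funext s
    rw [klPersp_eq (gaussianTilt_pos _ _ _) (gaussianTilt_pos _ _ _), klFun_apply]
    have : ∀ c, Real.log (gaussianTilt v c s) = c * s - v * c ^ 2 / 2 := fun c => Real.log_exp _
    rw [this, this]
    ring
  have i1 := (integrable_mul_gaussianTilt_right v c).const_mul (c - d)
  have i2 := (integrable_gaussianTilt_right v c).const_mul (v * (c ^ 2 - d ^ 2) / 2 + 1)
  have i3 := integrable_gaussianTilt_right v d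
  have i4 : Integrable (fun s => (c - d) * (s * gaussianTilt v c s)
      - (v * (c ^ 2 - d ^ 2) / 2 + 1) * gaussianTilt v c s) (gaussianReal 0 v) := i1.sub i2
  have hi : Integrable (fun s => klPersp (gaussianTilt v c s) (gaussianTilt v d s))
      (gaussianReal 0 v) := by rw [e]; exact i4.add i3
  rw [← ofReal_integral_eq_lintegral_ofReal hi (ae_of_all _ fun s =>
    klPersp_nonneg (gaussianTilt_pos _ _ _).le (gaussianTilt_pos _ _ _).le)]
  congr 1
  rw [e, integral_add i4 i3, integral_sub i1 i2, integral_const_mul, integral_const_mul,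
    integral_gaussianTilt_right, integral_gaussianTilt_right, integral_mul_gaussianTilt_right]
  ring

/-! ### Second-order behaviour as the gain tends to zero -/

lemma hasDerivAt_gaussianTilt (v : ℝ≥0) (x s ε : ℝ) :
    HasDerivAt (fun ε => gaussianTilt v (ε * x) s)
      (gaussianTilt v (ε * x) s * (x * s - v * ε * x ^ 2)) ε := by
  have h1 : HasDerivAt (fun ε : ℝ => ε * x * s - v * (ε * x) ^ 2 / 2) (x * s - v * ε * x ^ 2) ε := by
    have a := ((hasDerivAt_id ε).mul_const x)
    have := (a.mul_const s).sub (((a.pow 2).const_mul (v : ℝ)).div_const 2)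
    exact this.congr_deriv (by simp only [id]; push_cast; ring)
  exact h1.exp

lemma hasDerivAt_gaussianTiltMix {v : ℝ≥0} {s : ℝ} (h : v = 0 → s = 0)
    {ν : Measure ℝ} [IsProbabilityMeasure ν] (hν : MemLp id 2 ν) :
    HasDerivAt (fun ε => gaussianTiltMix v ν ε s) (s * ∫ x, x ∂ν) 0 := by
  have hx1 : Integrable (fun x : ℝ => x) ν := hν.integrable (by norm_num)
  have hx2 : Integrable (fun x : ℝ => x ^ 2) ν := hν.integrable_sq
  set M := Real.exp (s ^ 2 / (2 * v)) with hM
  -- Dominates the ε-derivative for |ε| ≤ 1; the x² term is where the second moment is used.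
  have hb : Integrable (fun x : ℝ => M * (|x| * |s| + v * x ^ 2)) ν :=
    ((hx1.abs.mul_const _).add (hx2.const_mul _)).const_mul _
  have := (hasDerivAt_integral_of_dominated_loc_of_deriv_le (μ := ν) (x₀ := (0 : ℝ))
    (F := fun ε x => gaussianTilt v (ε * x) s)
    (F' := fun ε x => gaussianTilt v (ε * x) s * (x * s - v * ε * x ^ 2))
    (Metric.ball_mem_nhds (0 : ℝ) one_pos)
    (Eventually.of_forall fun ε => (continuous_gaussianTilt_left v ε s).aestronglyMeasurable)
    (integrable_gaussianTilt_left h ν 0)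
    ((by unfold gaussianTilt; fun_prop : Continuous fun x : ℝ =>
      gaussianTilt v (0 * x) s * (x * s - v * 0 * x ^ 2)).aestronglyMeasurable)
    (ae_of_all _ fun x ε hε => by
      rw [norm_mul, Real.norm_of_nonneg (gaussianTilt_pos _ _ _).le]
      refine mul_le_mul (gaussianTilt_le h _) ?_ (norm_nonneg _) (Real.exp_pos _).le
      refine (norm_sub_le _ _).trans (add_le_add (by rw [norm_mul]; rfl) ?_)
      have hε' : |ε| ≤ 1 := by simpa using (Metric.mem_ball.1 hε).le
      rw [norm_mul, norm_mul, norm_pow, Real.norm_eq_abs, Real.norm_eq_abs, Real.norm_eq_abs,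
        sq_abs, NNReal.abs_eq]
      refine mul_le_mul_of_nonneg_right ?_ (sq_nonneg x)
      exact mul_le_of_le_one_right v.2 hε')
    hb (ae_of_all _ fun x ε _ => hasDerivAt_gaussianTilt v x s ε)).2
  refine this.congr_deriv ?_
  rw [← integral_const_mul]
  congr 1
  funext x
  simp [gaussianTilt]; ring

lemma tendsto_klFun_div_sq :
    Tendsto (fun t => klFun t / (t - 1) ^ 2) (𝓝[≠] 1) (𝓝 (1 / 2)) := by
  have hd : Tendsto (fun t => Real.log t / (2 * (t - 1))) (𝓝[≠] 1) (𝓝 (1 / 2)) := by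
    have h := hasDerivAt_iff_tendsto_slope.1 (Real.hasDerivAt_log one_ne_zero)
    have h2 := h.const_mul (1 / 2 : ℝ)
    simp only [inv_one, mul_one] at h2
    refine h2.congr fun t => ?_
    rw [slope_def_field, Real.log_one, sub_zero]
    rw [div_mul_div_comm, one_mul]
  refine HasDerivAt.lhopital_zero_nhdsNE (f' := Real.log) (g' := fun t => 2 * (t - 1))
    ?_ ?_ ?_ ?_ ?_ hd
  · filter_upwards [nhdsWithin_le_nhds (eventually_ne_nhds one_ne_zero)] with t ht
    exact hasDerivAt_klFun ht
  · refine Eventually.of_forall fun t => ?_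
    have := ((hasDerivAt_id t).sub_const 1).pow 2
    exact this.congr_deriv (by simp)
  · filter_upwards [self_mem_nhdsWithin] with t ht
    exact mul_ne_zero two_ne_zero (sub_ne_zero.2 ht)
  · have := continuous_klFun.tendsto (1 : ℝ)
    rw [klFun_one] at this
    exact this.mono_left nhdsWithin_le_nhds
  · have : Tendsto (fun t : ℝ => (t - 1) ^ 2) (𝓝 1) (𝓝 ((1 - 1) ^ 2)) := by
      exact ((continuous_id.sub continuous_const).pow 2).tendsto _
    simp only [sub_self, ne_eq, OfNat.ofNat_ne_zero, not_false_eq_true, zero_pow] at this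
    exact this.mono_left nhdsWithin_le_nhds

lemma tendsto_klFun_comp_div_sq {f : ℝ → ℝ} {d : ℝ} (hf : HasDerivAt f d 0) (h0 : f 0 = 1) :
    Tendsto (fun ε => klFun (f ε) / ε ^ 2) (𝓝[>] 0) (𝓝 (d ^ 2 / 2)) := by
  -- `f ε` may equal 1 for ε ≠ 0, so the quotient is extended continuously to 1.
  set G : ℝ → ℝ := Function.update (fun t => klFun t / (t - 1) ^ 2) 1 (1 / 2) with hG
  have hGc : ContinuousAt G 1 := continuousAt_update_same.2 tendsto_klFun_div_sq
  have hGe : ∀ t, klFun t = G t * (t - 1) ^ 2 := by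
    intro t
    rcases eq_or_ne t 1 with rfl | ht
    · simp [klFun_one]
    · rw [hG, Function.update_of_ne ht, div_mul_cancel₀]
      exact pow_ne_zero _ (sub_ne_zero.2 ht)
  have hfc : Tendsto f (𝓝[>] 0) (𝓝 1) := by
    have := hf.continuousAt.tendsto
    rw [h0] at this
    exact this.mono_left nhdsWithin_le_nhds
  have h1 : Tendsto (fun ε => G (f ε)) (𝓝[>] 0) (𝓝 (1 / 2)) := by
    have := hGc.tendsto.comp hfc
    simpa [hG, Function.comp_def] using this
  have h2 : Tendsto (fun ε => ((f ε - 1) / ε) ^ 2) (𝓝[>] 0) (𝓝 (d ^ 2)) := by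
    have := (hasDerivAt_iff_tendsto_slope.1 hf).mono_left
      (nhdsWithin_mono 0 (fun x (hx : 0 < x) => ne_of_gt hx))
    refine (this.pow 2).congr fun ε => ?_
    rw [slope_def_field, h0, sub_zero]
  have := h1.mul h2
  rw [show d ^ 2 / 2 = 1 / 2 * d ^ 2 by ring]
  refine this.congr fun ε => ?_
  rw [hGe (f ε), div_pow, mul_div_assoc]

lemma gaussianTiltMix_zero (v : ℝ≥0) (ν : Measure ℝ) [IsProbabilityMeasure ν] (s : ℝ) :
    gaussianTiltMix v ν 0 s = 1 := by
  simp [gaussianTiltMix, gaussianTilt]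

/-- The ratio of tilt to mixture equals 1 at ε = 0 with derivative s(x - m), and `klFun` behaves
like (t - 1)²/2 near 1. -/
lemma tendsto_klPersp_gaussianTilt_div_sq {v : ℝ≥0} {s : ℝ} (h : v = 0 → s = 0)
    {ν : Measure ℝ} [IsProbabilityMeasure ν] (hν : MemLp id 2 ν) (x : ℝ) :
    Tendsto (fun ε => klPersp (gaussianTilt v (ε * x) s) (gaussianTiltMix v ν ε s) / ε ^ 2)
      (𝓝[>] 0) (𝓝 ((s * (x - ∫ x, x ∂ν)) ^ 2 / 2)) := by
  have hm := hasDerivAt_gaussianTiltMix h hν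
  have h0 := gaussianTiltMix_zero v ν s
  have hq := (hasDerivAt_gaussianTilt v x s 0).fun_div hm (by rw [h0]; exact one_ne_zero)
  have h1 := tendsto_klFun_comp_div_sq hq (by simp [h0, gaussianTilt])
  have h2 : Tendsto (fun ε => gaussianTiltMix v ν ε s) (𝓝[>] 0) (𝓝 1) := by
    have := hm.continuousAt.tendsto
    rw [h0] at this
    exact this.mono_left nhdsWithin_le_nhds
  have h3 := h2.mul h1
  simp only [klPersp, mul_div_assoc]
  refine h3.trans (le_of_eq ?_)
  congr 1
  rw [h0]
  simp [gaussianTilt]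
  ring
-- Upper and lower bounds for the information of one channel
/-- The mutual information (in nats) between `x ∼ ν` and an observation of `x` with gain `ε` in
Gaussian noise, expressed through the sufficient statistic `s ∼ gaussianReal 0 v`. -/
noncomputable def gaussianInfo (v : ℝ≥0) (ν : Measure ℝ) (ε : ℝ) : ℝ≥0∞ :=
  ∫⁻ s, ∫⁻ x, ENNReal.ofReal (klPersp (gaussianTilt v (ε * x) s) (gaussianTiltMix v ν ε s)) ∂ν
    ∂gaussianReal 0 v

lemma ae_eq_zero_of_gaussianReal (v : ℝ≥0) : ∀ᵐ s ∂gaussianReal 0 v, v = 0 → s = 0 := by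
  rcases eq_or_ne v 0 with rfl | hv
  · simp [gaussianReal_zero_var]
  · exact ae_of_all _ fun s h => absurd h hv

lemma measurable_gaussianTilt_comp {α : Type*} [MeasurableSpace α] (v : ℝ≥0) {f g : α → ℝ}
    (hf : Measurable f) (hg : Measurable g) : Measurable fun a => gaussianTilt v (f a) (g a) :=
  (continuous_gaussianTilt v).measurable.comp (hf.prodMk hg)

lemma measurable_klPersp_comp {α : Type*} [MeasurableSpace α] {f g : α → ℝ}
    (hf : Measurable f) (hg : Measurable g) : Measurable fun a => klPersp (f a) (g a) :=
  measurable_klPersp.comp (hf.prodMk hg)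

lemma measurable_gaussianTiltMix (v : ℝ≥0) (ν : Measure ℝ) [IsProbabilityMeasure ν] (ε : ℝ) :
    Measurable (gaussianTiltMix v ν ε) := by
  have : StronglyMeasurable fun q : ℝ × ℝ => gaussianTilt v (ε * q.2) q.1 :=
    (measurable_gaussianTilt_comp v (by fun_prop) (by fun_prop)).stronglyMeasurable
  exact this.integral_prod_right'.measurable

lemma measurable_klPersp_gaussianTiltMix (v : ℝ≥0) (ν : Measure ℝ) [IsProbabilityMeasure ν]
    (ε : ℝ) : Measurable fun q : ℝ × ℝ =>
      klPersp (gaussianTilt v (ε * q.2) q.1) (gaussianTiltMix v ν ε q.1) :=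
  measurable_klPersp_comp (measurable_gaussianTilt_comp v (by fun_prop) (by fun_prop))
    ((measurable_gaussianTiltMix v ν ε).comp measurable_fst)

lemma gaussianInfo_le (v : ℝ≥0) (ν : Measure ℝ) [IsProbabilityMeasure ν] (ε : ℝ) :
    gaussianInfo v ν ε ≤ ENNReal.ofReal (ε ^ 2) *
      (ENNReal.ofReal (v / 2) * ∫⁻ x, ENNReal.ofReal ((x - ∫ t, t ∂ν) ^ 2) ∂ν) := by
  set m := ∫ t, t ∂ν
  calc gaussianInfo v ν ε
      ≤ ∫⁻ s, ∫⁻ x, ENNReal.ofReal (klPersp (gaussianTilt v (ε * x) s)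
          (gaussianTilt v (ε * m) s)) ∂ν ∂gaussianReal 0 v := by
        refine lintegral_mono_ae ?_
        filter_upwards [ae_eq_zero_of_gaussianReal v] with s hs
        exact lintegral_klPersp_gaussianTiltMix_le hs ν ε (gaussianTilt_pos _ _ _)
    _ = ∫⁻ x, ∫⁻ s, ENNReal.ofReal (klPersp (gaussianTilt v (ε * x) s)
          (gaussianTilt v (ε * m) s)) ∂gaussianReal 0 v ∂ν := by
        refine lintegral_lintegral_swap (Measurable.aemeasurable ?_)
        exact (measurable_klPersp_comp (measurable_gaussianTilt_comp v (by fun_prop) (by fun_prop))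
          (measurable_gaussianTilt_comp v (by fun_prop) (by fun_prop))).ennreal_ofReal
    _ = ENNReal.ofReal (ε ^ 2) * (ENNReal.ofReal (v / 2) *
          ∫⁻ x, ENNReal.ofReal ((x - m) ^ 2) ∂ν) := by
        rw [← lintegral_const_mul _ (by fun_prop), ← lintegral_const_mul _ (by fun_prop)]
        refine lintegral_congr fun x => ?_
        rw [lintegral_klPersp_gaussianTilt, ← ENNReal.ofReal_mul (by positivity),
          ← ENNReal.ofReal_mul (by positivity)]
        congr 1
        ring

lemma lintegral_sq_gaussianReal (v : ℝ≥0) :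
    ∫⁻ s, ENNReal.ofReal (s ^ 2) ∂gaussianReal 0 v = ENNReal.ofReal v := by
  have h2 : MemLp id 2 (gaussianReal 0 v) := memLp_id_gaussianReal' 2 (by simp)
  have hi : Integrable (fun s : ℝ => s ^ 2) (gaussianReal 0 v) := h2.integrable_sq
  rw [← ofReal_integral_eq_lintegral_ofReal hi (ae_of_all _ fun s => sq_nonneg s)]
  congr 1
  have := variance_id_gaussianReal (μ := 0) (v := v)
  rw [variance_eq_sub h2] at this
  simpa [integral_id_gaussianReal] using this

/-- Fatou on the product measure; the integral of the pointwise limit factors into E[s²] = v and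
half the variance of ν. -/
lemma le_liminf_gaussianInfo (v : ℝ≥0) {ν : Measure ℝ} [IsProbabilityMeasure ν]
    (hν : MemLp id 2 ν) {u : ℕ → ℝ} (hu : Tendsto u atTop (𝓝[>] 0)) :
    ENNReal.ofReal (v / 2) * ∫⁻ x, ENNReal.ofReal ((x - ∫ t, t ∂ν) ^ 2) ∂ν ≤
      liminf (fun n => ENNReal.ofReal (1 / u n ^ 2) * gaussianInfo v ν (u n)) atTop := by
  set m := ∫ t, t ∂ν
  set F : ℝ → ℝ × ℝ → ℝ := fun ε q =>
    klPersp (gaussianTilt v (ε * q.2) q.1) (gaussianTiltMix v ν ε q.1) / ε ^ 2 with hF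
  have hFm : ∀ ε, Measurable fun q => ENNReal.ofReal (F ε q) := fun ε =>
    ((measurable_klPersp_gaussianTiltMix v ν ε).div_const _).ennreal_ofReal
  have hval : ∀ ε, ENNReal.ofReal (1 / ε ^ 2) * gaussianInfo v ν ε =
      ∫⁻ q, ENNReal.ofReal (F ε q) ∂((gaussianReal 0 v).prod ν) := by
    intro ε
    have hm := (measurable_klPersp_gaussianTiltMix v ν ε).ennreal_ofReal
    rw [gaussianInfo, ← lintegral_prod _ hm.aemeasurable, ← lintegral_const_mul _ hm]
    refine lintegral_congr fun q => ?_
    rw [← ENNReal.ofReal_mul (by positivity), hF]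
    congr 1
    ring
  have hlim : ∀ᵐ q ∂((gaussianReal 0 v).prod ν), ENNReal.ofReal ((q.1 * (q.2 - m)) ^ 2 / 2) =
      liminf (fun n => ENNReal.ofReal (F (u n) q)) atTop := by
    have hae : ∀ᵐ q ∂((gaussianReal 0 v).prod ν), v = 0 → q.1 = 0 :=
      Measure.quasiMeasurePreserving_fst.ae (ae_eq_zero_of_gaussianReal v)
    filter_upwards [hae] with q hq
    exact ((ENNReal.continuous_ofReal.tendsto _).comp
      ((tendsto_klPersp_gaussianTilt_div_sq hq hν q.2).comp hu)).liminf_eq.symm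
  calc ENNReal.ofReal (v / 2) * ∫⁻ x, ENNReal.ofReal ((x - m) ^ 2) ∂ν
      = ∫⁻ q, ENNReal.ofReal ((q.1 * (q.2 - m)) ^ 2 / 2) ∂((gaussianReal 0 v).prod ν) := by
        have e : ∀ q : ℝ × ℝ, ENNReal.ofReal ((q.1 * (q.2 - m)) ^ 2 / 2) =
            ENNReal.ofReal (q.1 ^ 2) * ENNReal.ofReal ((q.2 - m) ^ 2 / 2) := fun q => by
          rw [← ENNReal.ofReal_mul (by positivity)]; congr 1; ring
        simp_rw [e]
        rw [lintegral_prod_mul (f := fun s => ENNReal.ofReal (s ^ 2))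
          (g := fun x => ENNReal.ofReal ((x - m) ^ 2 / 2)) (by fun_prop) (by fun_prop),
          lintegral_sq_gaussianReal, ← lintegral_const_mul _ (by fun_prop),
          ← lintegral_const_mul _ (by fun_prop)]
        refine lintegral_congr fun x => ?_
        rw [← ENNReal.ofReal_mul (by positivity), ← ENNReal.ofReal_mul (by positivity)]
        congr 1; ring
    _ = ∫⁻ q, liminf (fun n => ENNReal.ofReal (F (u n) q)) atTop ∂((gaussianReal 0 v).prod ν) :=
        lintegral_congr_ae hlim
    _ ≤ liminf (fun n => ∫⁻ q, ENNReal.ofReal (F (u n) q) ∂((gaussianReal 0 v).prod ν)) atTop :=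
        lintegral_liminf_le fun n => hFm (u n)
    _ = _ := by simp_rw [hval]

lemma ofReal_inv_sq_mul_gaussianInfo_le (v : ℝ≥0) (ν : Measure ℝ) [IsProbabilityMeasure ν]
    {ε : ℝ} (hε : 0 < ε) : ENNReal.ofReal (1 / ε ^ 2) * gaussianInfo v ν ε ≤
      ENNReal.ofReal (v / 2) * ∫⁻ x, ENNReal.ofReal ((x - ∫ t, t ∂ν) ^ 2) ∂ν := by
  refine (mul_le_mul_right (gaussianInfo_le v ν ε) _).trans (le_of_eq ?_)
  rw [← mul_assoc, ← ENNReal.ofReal_mul (by positivity), one_div_mul_cancel (by positivity),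
    ENNReal.ofReal_one, one_mul]

lemma tendsto_gaussianInfo (v : ℝ≥0) {ν : Measure ℝ} [IsProbabilityMeasure ν]
    (hν : MemLp id 2 ν) :
    Tendsto (fun ε => ENNReal.ofReal (1 / ε ^ 2) * gaussianInfo v ν ε) (𝓝[>] 0)
      (𝓝 (ENNReal.ofReal (v / 2) * ∫⁻ x, ENNReal.ofReal ((x - ∫ t, t ∂ν) ^ 2) ∂ν)) := by
  -- Fatou was applied along sequences, so the filter limit is reduced to them.
  refine tendsto_of_seq_tendsto fun u hu => ?_
  refine tendsto_of_le_liminf_of_limsup_le (le_liminf_gaussianInfo v hν hu) ?_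
  refine limsup_le_of_le (by isBoundedDefault) ?_
  filter_upwards [hu.eventually self_mem_nhdsWithin] with n hn
  exact ofReal_inv_sq_mul_gaussianInfo_le v ν hn

/-! ### Densities, relative entropy and Gaussian sums -/

/-- Relative entropy of two measures with positive densities against a common reference. -/
lemma klDiv_withDensity_ofReal {α : Type*} [MeasurableSpace α] (ρ : Measure α) [SigmaFinite ρ]
    {p r : α → ℝ} (hp : Measurable p) (hr : Measurable r) (hp0 : ∀ a, 0 < p a) (hr0 : ∀ a, 0 < r a)
    [IsFiniteMeasure (ρ.withDensity fun a => ENNReal.ofReal (p a))]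
    [IsFiniteMeasure (ρ.withDensity fun a => ENNReal.ofReal (r a))] :
    klDiv (ρ.withDensity fun a => ENNReal.ofReal (p a))
      (ρ.withDensity fun a => ENNReal.ofReal (r a)) =
      ∫⁻ a, ENNReal.ofReal (klPersp (p a) (r a)) ∂ρ := by
  set Q := ρ.withDensity fun a => ENNReal.ofReal (r a) with hQ
  have hP : ρ.withDensity (fun a => ENNReal.ofReal (p a)) =
      Q.withDensity fun a => ENNReal.ofReal (p a / r a) := by
    rw [hQ, ← withDensity_mul _ (by fun_prop) (by fun_prop)]
    congr 1
    funext a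
    rw [Pi.mul_apply, ← ENNReal.ofReal_mul (hr0 a).le, mul_div_cancel₀ _ (hr0 a).ne']
  have hac : ρ.withDensity (fun a => ENNReal.ofReal (p a)) ≪ Q := by
    rw [hP]; exact withDensity_absolutelyContinuous _ _
  rw [klDiv_eq_lintegral_klFun_of_ac hac]
  have hd : (ρ.withDensity fun a => ENNReal.ofReal (p a)).rnDeriv Q =ᵐ[Q]
      fun a => ENNReal.ofReal (p a / r a) := by
    rw [hP]; exact Measure.rnDeriv_withDensity Q (by fun_prop)
  calc _ = ∫⁻ a, ENNReal.ofReal (klFun (p a / r a)) ∂Q := by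
        refine lintegral_congr_ae ?_
        filter_upwards [hd] with a ha
        rw [ha, ENNReal.toReal_ofReal (div_pos (hp0 a) (hr0 a)).le]
    _ = _ := by
        have hk : Measurable fun a => ENNReal.ofReal (klFun (p a / r a)) :=
          (measurable_klFun.comp (hp.div hr)).ennreal_ofReal
        rw [hQ, lintegral_withDensity_eq_lintegral_mul _ (by fun_prop) hk]
        refine lintegral_congr fun a => ?_
        rw [Pi.mul_apply, ← ENNReal.ofReal_mul (hr0 a).le, klPersp]

lemma map_sum_gaussianReal {Ω ι : Type*} [MeasurableSpace Ω] {P : Measure Ω}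
    {N : ι → Ω → ℝ} (hN : ∀ i, Measurable (N i)) (hind : iIndepFun N P)
    (hlaw : ∀ i, P.map (N i) = gaussianReal 0 1) (t : Finset ι) :
    P.map (∑ i ∈ t, N i) = gaussianReal 0 t.card := by
  have := hind.isProbabilityMeasure
  induction t using Finset.cons_induction with
  | empty =>
    simp only [Finset.sum_empty, Finset.card_empty, Nat.cast_zero, gaussianReal_zero_var]
    have : (0 : Ω → ℝ) = fun _ => 0 := rfl
    rw [this, Measure.map_const]
    simp
  | cons j t hj ih =>
    rw [Finset.sum_cons, Finset.card_cons]
    have h := gaussianReal_add_gaussianReal_of_indepFun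
      (hind.indepFun_finsetSum_of_notMem hN hj).symm (hlaw j) ih
    rw [h]
    simp [add_comm]

lemma gaussianReal_map_const_add_eq_withDensity (c : ℝ) :
    (gaussianReal 0 1).map (c + ·) =
      (gaussianReal 0 1).withDensity fun s => ENNReal.ofReal (gaussianTilt 1 c s) := by
  rw [gaussianReal_map_const_add, gaussianReal_of_var_ne_zero _ one_ne_zero,
    gaussianReal_of_var_ne_zero _ one_ne_zero, ← withDensity_mul _ (by fun_prop)
      (measurable_gaussianTilt_comp 1 (by fun_prop) (by fun_prop)).ennreal_ofReal]
  congr 1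
  funext s
  rw [Pi.mul_apply, gaussianPDF, gaussianPDF, ← ENNReal.ofReal_mul (gaussianPDFReal_nonneg _ _ _),
    gaussianPDFReal, gaussianPDFReal, gaussianTilt, mul_assoc (_⁻¹), ← Real.exp_add]
  congr 3
  simp
  ring

/-! ### The vector channel and its sufficient statistic -/

section Vector

variable {ι : Type*} [Fintype ι]

/-- The standard Gaussian measure on `ι → ℝ`. -/
noncomputable abbrev stdGaussianPi (ι : Type*) [Fintype ι] : Measure (ι → ℝ) :=
  Measure.pi fun _ => gaussianReal 0 1

lemma stdGaussianPi_map_sum :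
    (stdGaussianPi ι).map (fun y => ∑ i, y i) = gaussianReal 0 (Fintype.card ι) := by
  have h := map_sum_gaussianReal (P := stdGaussianPi ι) (N := fun i y => y i)
    (fun i => measurable_pi_apply i)
    (iIndepFun_pi (X := fun _ => id) (fun _ => aemeasurable_id))
    (fun i => (measurePreserving_eval (fun _ : ι => gaussianReal 0 1) i).map_eq) Finset.univ
  rw [Finset.card_univ] at h
  rw [← h]
  congr 1
  funext y
  simp

lemma gaussianTilt_card_sum (c : ℝ) (y : ι → ℝ) :
    gaussianTilt (Fintype.card ι) c (∑ i, y i) = ∏ i, gaussianTilt 1 c (y i) := by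
  simp only [gaussianTilt, ← Real.exp_sum, Finset.sum_sub_distrib, Finset.mul_sum]
  simp
  ring

lemma stdGaussianPi_map_const_add (c : ℝ) :
    (stdGaussianPi ι).map (fun y i => c + y i) = (stdGaussianPi ι).withDensity
      fun y => ENNReal.ofReal (gaussianTilt (Fintype.card ι) c (∑ i, y i)) := by
  have hprob : IsProbabilityMeasure ((gaussianReal 0 1).map (c + ·)) :=
    Measure.isProbabilityMeasure_map (by fun_prop)
  have h1 : (stdGaussianPi ι).map (fun y i => c + y i) =
      Measure.pi fun _ => (gaussianReal 0 1).map (c + ·) :=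
    Measure.pi_map_pi (μ := fun _ => gaussianReal 0 1) (f := fun _ x => c + x)
      (fun _ => by fun_prop)
  rw [h1]
  -- It suffices to compare on boxes, where the density splits over independent coordinates.
  refine Measure.pi_eq fun s hs => ?_
  have hm : Measurable fun x => ENNReal.ofReal (gaussianTilt 1 c x) :=
    (measurable_gaussianTilt_comp 1 (by fun_prop) (by fun_prop)).ennreal_ofReal
  rw [withDensity_apply _ (MeasurableSet.univ_pi hs),
    ← lintegral_indicator (MeasurableSet.univ_pi hs)]
  have e : ∀ y : ι → ℝ, (Set.univ.pi s).indicator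
      (fun y => ENNReal.ofReal (gaussianTilt (Fintype.card ι) c (∑ i, y i))) y =
      ∏ i, (s i).indicator (fun x => ENNReal.ofReal (gaussianTilt 1 c x)) (y i) := by
    intro y
    by_cases hy : y ∈ Set.univ.pi s
    · rw [Set.indicator_of_mem hy, gaussianTilt_card_sum,
        ENNReal.ofReal_prod_of_nonneg fun i _ => (gaussianTilt_pos _ _ _).le]
      exact Finset.prod_congr rfl fun i _ => by
        rw [Set.indicator_of_mem (hy i trivial)]
    · rw [Set.indicator_of_notMem hy]
      obtain ⟨i, hi⟩ : ∃ i, y i ∉ s i := by simpa [Set.mem_pi] using hy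
      exact (Finset.prod_eq_zero (Finset.mem_univ i) (Set.indicator_of_notMem hi _)).symm
  simp_rw [e]
  rw [lintegral_prod_eq_prod_lintegral_of_indepFun Finset.univ
    (fun i (y : ι → ℝ) => (s i).indicator (fun x => ENNReal.ofReal (gaussianTilt 1 c x)) (y i))
    (iIndepFun_pi (X := fun i => (s i).indicator fun x => ENNReal.ofReal (gaussianTilt 1 c x))
      (fun i => (hm.indicator (hs i)).aemeasurable))
    (fun i => (hm.indicator (hs i)).comp (measurable_pi_apply i))]
  refine Finset.prod_congr rfl fun i _ => ?_
  have h2 := (measurePreserving_eval (fun _ : ι => gaussianReal 0 1) i).lintegral_comp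
    (hm.indicator (hs i))
  rw [gaussianReal_map_const_add_eq_withDensity, withDensity_apply _ (hs i),
    ← lintegral_indicator (hs i), ← h2]

/-- The channel map `(x, n) ↦ (x, ε x + n)`. -/
def gaussianChannel (ι : Type*) (ε : ℝ) (q : ℝ × (ι → ℝ)) : ℝ × (ι → ℝ) :=
  (q.1, fun i => ε * q.1 + q.2 i)

lemma measurable_gaussianChannel {ι : Type*} (ε : ℝ) : Measurable (gaussianChannel ι ε) := by
  unfold gaussianChannel; fun_prop

lemma measurable_gaussianTilt_sum (v : ℝ≥0) (ε : ℝ) : Measurable fun q : ℝ × (ι → ℝ) =>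
    gaussianTilt v (ε * q.1) (∑ i, q.2 i) :=
  measurable_gaussianTilt_comp v (by fun_prop) (by fun_prop)

/-- On the fibre over `x` the channel is the translation by εx, so Fubini reduces this to
`stdGaussianPi_map_const_add`. -/
lemma map_gaussianChannel (ν : Measure ℝ) (ε : ℝ) :
    (ν.prod (stdGaussianPi ι)).map (gaussianChannel ι ε) =
      (ν.prod (stdGaussianPi ι)).withDensity fun q =>
        ENNReal.ofReal (gaussianTilt (Fintype.card ι) (ε * q.1) (∑ i, q.2 i)) := by
  ext A hA
  have hd := (measurable_gaussianTilt_sum (ι := ι) (Fintype.card ι) ε).ennreal_ofReal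
  rw [Measure.map_apply (measurable_gaussianChannel ε) hA,
    Measure.prod_apply (measurable_gaussianChannel ε hA), withDensity_apply _ hA,
    ← lintegral_indicator hA, lintegral_prod _ (hd.indicator hA).aemeasurable]
  refine lintegral_congr fun x => ?_
  have hs : MeasurableSet (Prod.mk x ⁻¹' A) := measurable_prodMk_left hA
  have h := congrArg (fun m => m (Prod.mk x ⁻¹' A)) (stdGaussianPi_map_const_add (ι := ι) (ε * x))
  beta_reduce at h
  rw [Measure.map_apply (by fun_prop) hs, withDensity_apply _ hs, ← lintegral_indicator hs] at h
  exact h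

lemma card_eq_zero_imp_sum_eq_zero (y : ι → ℝ) :
    (Fintype.card ι : ℝ≥0) = 0 → ∑ i, y i = 0 := by
  intro h
  have : IsEmpty ι := Fintype.card_eq_zero_iff.1 (by exact_mod_cast h)
  simp

variable (ν : Measure ℝ) [IsProbabilityMeasure ν] (ε : ℝ)

lemma map_snd_gaussianChannel :
    (ν.prod (stdGaussianPi ι)).map (fun q => (gaussianChannel ι ε q).2) =
      (stdGaussianPi ι).withDensity fun y =>
        ENNReal.ofReal (gaussianTiltMix (Fintype.card ι) ν ε (∑ i, y i)) := by
  have hd := (measurable_gaussianTilt_sum (ι := ι) (Fintype.card ι) ε).ennreal_ofReal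
  have h := Measure.map_map (μ := ν.prod (stdGaussianPi ι)) measurable_snd
    (measurable_gaussianChannel (ι := ι) ε)
  have hfun : (fun q => (gaussianChannel ι ε q).2) = Prod.snd ∘ gaussianChannel ι ε := rfl
  rw [hfun, ← h, map_gaussianChannel]
  ext A hA
  rw [Measure.map_apply measurable_snd hA, withDensity_apply _ (measurable_snd hA),
    withDensity_apply _ hA, ← Set.univ_prod, ← Measure.prod_restrict, Measure.restrict_univ,
    lintegral_prod_symm _ hd.aemeasurable]
  refine lintegral_congr fun y => ?_
  rw [gaussianTiltMix, ofReal_integral_eq_lintegral_ofReal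
    (integrable_gaussianTilt_left (card_eq_zero_imp_sum_eq_zero y) ν ε)
    (ae_of_all _ fun x => (gaussianTilt_pos _ _ _).le)]

/-- The mutual information of the Gaussian channel. -/
lemma klDiv_gaussianChannel :
    klDiv ((ν.prod (stdGaussianPi ι)).map (gaussianChannel ι ε))
      (ν.prod ((ν.prod (stdGaussianPi ι)).map fun q => (gaussianChannel ι ε q).2)) =
      gaussianInfo (Fintype.card ι) ν ε := by
  have hmix : Measurable fun y : ι → ℝ => gaussianTiltMix (Fintype.card ι) ν ε (∑ i, y i) :=
    (measurable_gaussianTiltMix _ ν ε).comp (by fun_prop)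
  have hprod : ν.prod ((ν.prod (stdGaussianPi ι)).map fun q => (gaussianChannel ι ε q).2) =
      (ν.prod (stdGaussianPi ι)).withDensity fun q =>
        ENNReal.ofReal (gaussianTiltMix (Fintype.card ι) ν ε (∑ i, q.2 i)) := by
    rw [map_snd_gaussianChannel, prod_withDensity_right hmix.ennreal_ofReal]
  have hmix' : Measurable fun q : ℝ × (ι → ℝ) =>
      gaussianTiltMix (Fintype.card ι) ν ε (∑ i, q.2 i) := hmix.comp measurable_snd
  have hfin2 : IsFiniteMeasure ((ν.prod (stdGaussianPi ι)).withDensity fun q =>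
      ENNReal.ofReal (gaussianTiltMix (Fintype.card ι) ν ε (∑ i, q.2 i))) := by
    rw [← hprod]; infer_instance
  have hfin1 : IsFiniteMeasure ((ν.prod (stdGaussianPi ι)).withDensity fun q =>
      ENNReal.ofReal (gaussianTilt (Fintype.card ι) (ε * q.1) (∑ i, q.2 i))) := by
    rw [← map_gaussianChannel]; infer_instance
  have hk : Measurable fun q : ℝ × (ι → ℝ) => ENNReal.ofReal
      (klPersp (gaussianTilt (Fintype.card ι) (ε * q.1) (∑ i, q.2 i))
        (gaussianTiltMix (Fintype.card ι) ν ε (∑ i, q.2 i))) :=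
    (measurable_klPersp_comp (measurable_gaussianTilt_sum _ ε) hmix').ennreal_ofReal
  rw [hprod, map_gaussianChannel, klDiv_withDensity_ofReal (ν.prod (stdGaussianPi ι))
    (measurable_gaussianTilt_sum _ ε) hmix'
    (fun q => gaussianTilt_pos _ _ _)
    (fun q => gaussianTiltMix_pos (card_eq_zero_imp_sum_eq_zero q.2) ν ε),
    -- The integrand sees `y` only through its sum, so the outer integral is pushed forward to the
    -- one-dimensional Gaussian.
    lintegral_prod_symm _ hk.aemeasurable, gaussianInfo, ← stdGaussianPi_map_sum,
    lintegral_map _ (by fun_prop)]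
  exact (measurable_klPersp_gaussianTiltMix _ ν ε).ennreal_ofReal.lintegral_prod_right'

end Vector
-- Conditioning on the side information
section Conditional

variable {Ω C : Type*} [MeasurableSpace Ω] [MeasurableSpace C]

/-- Conditional laws are determined by disintegration of the joint law: independence makes the law
of ((Z, X), N) a product, and its first factor disintegrates along `Z`. -/
lemma condDistrib_prodMk_of_indepFun {A B : Type*}
    [MeasurableSpace A] [StandardBorelSpace A] [Nonempty A]
    [MeasurableSpace B] [StandardBorelSpace B] [Nonempty B]
    {μ : Measure Ω} [IsProbabilityMeasure μ] {X : Ω → A} {Z : Ω → C} {N : Ω → B}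
    (hX : Measurable X) (hZ : Measurable Z) (hN : Measurable N)
    (h : IndepFun (fun ω => (X ω, Z ω)) N μ) :
    condDistrib (fun ω => (X ω, N ω)) Z μ =ᵐ[μ.map Z]
      (condDistrib X Z μ) ×ₖ Kernel.const C (μ.map N) := by
  have hprob : IsProbabilityMeasure (μ.map N) := Measure.isProbabilityMeasure_map hN.aemeasurable
  refine condDistrib_ae_eq_of_measure_eq_compProd Z (by fun_prop) ?_
  have hind : IndepFun (fun ω => (Z ω, X ω)) N μ :=
    h.comp (φ := Prod.swap) (ψ := id) measurable_swap measurable_id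
  have hlaw := (indepFun_iff_map_prod_eq_prod_map_map (by fun_prop) (by fun_prop)).1 hind
  rw [← compProd_map_condDistrib hX.aemeasurable] at hlaw
  refine Measure.ext_of_lintegral _ fun f hf => ?_
  have hg : Measurable fun q : (C × A) × B => f (q.1.1, (q.1.2, q.2)) := by fun_prop
  calc ∫⁻ a, f a ∂μ.map (fun ω => (Z ω, X ω, N ω))
      = ∫⁻ q, f (q.1.1, (q.1.2, q.2)) ∂μ.map (fun ω => ((Z ω, X ω), N ω)) := by
        rw [lintegral_map hf (by fun_prop), lintegral_map hg (by fun_prop)]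
    _ = ∫⁻ z, ∫⁻ x, ∫⁻ n, f (z, (x, n)) ∂μ.map N ∂condDistrib X Z μ z ∂μ.map Z := by
        rw [hlaw, lintegral_prod _ hg.aemeasurable, Measure.lintegral_compProd]
        exact hg.lintegral_prod_right'
    _ = ∫⁻ a, f a ∂(μ.map Z ⊗ₘ (condDistrib X Z μ ×ₖ Kernel.const C (μ.map N))) := by
        rw [Measure.lintegral_compProd hf]
        refine lintegral_congr fun z => ?_
        rw [Kernel.prod_apply, Kernel.const_apply, lintegral_prod _ (by fun_prop)]

lemma measurable_gaussianInfo_kernel (v : ℝ≥0) (κ : Kernel C ℝ) [IsMarkovKernel κ] (ε : ℝ) :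
    Measurable fun z => gaussianInfo v (κ z) ε := by
  have h1 : StronglyMeasurable fun q : (C × ℝ) × ℝ => gaussianTilt v (ε * q.2) q.1.2 :=
    (measurable_gaussianTilt_comp v (by fun_prop) (by fun_prop)).stronglyMeasurable
  have h2 : Measurable fun q : C × ℝ => gaussianTiltMix v (κ q.1) ε q.2 :=
    (h1.integral_kernel_prod_right' (κ := κ.prodMkRight ℝ)).measurable
  have h3 : Measurable fun q : (C × ℝ) × ℝ => ENNReal.ofReal
      (klPersp (gaussianTilt v (ε * q.2) q.1.2) (gaussianTiltMix v (κ q.1.1) ε q.1.2)) :=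
    (measurable_klPersp_comp h1.measurable (h2.comp measurable_fst)).ennreal_ofReal
  have h4 := h3.lintegral_kernel_prod_right' (κ := κ.prodMkRight ℝ)
  exact h4.lintegral_prod_right'

variable {μ : Measure Ω} [IsProbabilityMeasure μ] {X : Ω → ℝ} {Z : Ω → C}

lemma ae_memLp_condDistrib (hX : Measurable X) (hX2 : MemLp X 2 μ) (hZ : Measurable Z) :
    ∀ᵐ z ∂μ.map Z, MemLp id 2 (condDistrib X Z μ z) := by
  have hi : Integrable (fun q : C × ℝ => q.2 ^ 2) (μ.map fun ω => (Z ω, X ω)) := by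
    rw [integrable_map_measure (by fun_prop) (by fun_prop)]
    exact hX2.integrable_sq
  filter_upwards [hi.condDistrib_ae_map hX.aemeasurable] with z hz
  exact (memLp_two_iff_integrable_sq measurable_id.aestronglyMeasurable).2 hz

/-- The averaged conditional variance in terms of the regular conditional distribution. -/
lemma lintegral_condDistrib_sq_sub (hX : Measurable X) (hX2 : MemLp X 2 μ) (hZ : Measurable Z) :
    ∫⁻ z, ∫⁻ x, ENNReal.ofReal ((x - ∫ t, t ∂condDistrib X Z μ z) ^ 2) ∂condDistrib X Z μ z
      ∂μ.map Z = ENNReal.ofReal (avgCondVar μ X Z) := by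
  have hm : Measurable fun z => ∫ t, t ∂condDistrib X Z μ z :=
    (StronglyMeasurable.integral_condDistrib (f := fun q : C × ℝ => q.2)
      measurable_snd.stronglyMeasurable).measurable
  have hf : Measurable fun q : C × ℝ =>
      ENNReal.ofReal ((q.2 - ∫ t, t ∂condDistrib X Z μ q.1) ^ 2) :=
    ((measurable_snd.sub (hm.comp measurable_fst)).pow_const 2).ennreal_ofReal
  have hce := condExp_ae_eq_integral_condDistrib' hZ (hX2.integrable (by norm_num))
  have hL : MemLp (X - μ[X | MeasurableSpace.comap Z inferInstance]) 2 μ := 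
    hX2.sub (hX2.condExp (by norm_num))
  rw [← Measure.lintegral_compProd hf, compProd_map_condDistrib hX.aemeasurable,
    lintegral_map hf (by fun_prop), avgCondVar]
  unfold condVar
  rw [integral_condExp hZ.comap_le]
  have hi := hL.integrable_sq
  refine Eq.trans ?_ (ofReal_integral_eq_lintegral_ofReal hi (ae_of_all _ fun ω => sq_nonneg _)).symm
  refine lintegral_congr_ae ?_
  filter_upwards [hce] with ω hω
  simp [hω]

lemma condMutualInfo_gaussianChannel {ι : Type*} [Fintype ι] {N : ι → Ω → ℝ}
    (hX : Measurable X) (hZ : Measurable Z) (hN : ∀ i, Measurable (N i))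
    (hN_law : ∀ i, HasLaw (N i) (gaussianReal 0 1) μ) (hN_indep : iIndepFun N μ)
    (hXZN : IndepFun (fun ω => (X ω, Z ω)) (fun ω i => N i ω) μ) (ε : ℝ) :
    condMutualInfo μ X (fun ω i => ε * X ω + N i ω) Z =
      (∫⁻ z, gaussianInfo (Fintype.card ι) (condDistrib X Z μ z) ε ∂μ.map Z) /
        ENNReal.ofReal (Real.log 2) := by
  have hNm : Measurable fun ω i => N i ω := measurable_pi_iff.2 hN
  have hNl : μ.map (fun ω i => N i ω) = stdGaussianPi ι := by
    rw [(iIndepFun_iff_map_fun_eq_pi_map fun i => (hN i).aemeasurable).1 hN_indep]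
    simp_rw [fun i => (hN_law i).map_eq]
  have h0 := condDistrib_prodMk_of_indepFun hX hZ hNm hXZN
  have hXN : AEMeasurable (fun ω => (X ω, fun i => N i ω)) μ := (hX.prodMk hNm).aemeasurable
  -- Both the joint and the output conditional laws are images of the conditional law of (X, N).
  have h1 := condDistrib_comp (mβ := inferInstance) Z hXN (measurable_gaussianChannel (ι := ι) ε)
  have h2 := condDistrib_comp (mβ := inferInstance) Z hXN (measurable_gaussianChannel (ι := ι) ε).snd
  rw [hNl] at h0
  rw [condMutualInfo]
  congr 1
  refine lintegral_congr_ae ?_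
  filter_upwards [h0, h1, h2] with z hz0 hz1 hz2
  rw [Kernel.map_apply _ (measurable_gaussianChannel ε), hz0, Kernel.prod_apply,
    Kernel.const_apply] at hz1
  rw [Kernel.map_apply _ (measurable_gaussianChannel ε).snd, hz0, Kernel.prod_apply,
    Kernel.const_apply] at hz2
  rw [← klDiv_gaussianChannel, ← hz1, ← hz2]
  rfl

/-- Dominated convergence in `z`: the bound valid for every ε > 0 has a finite integral,
proportional to the averaged conditional variance, and almost every conditional law has a finite
second moment. -/
lemma tendsto_lintegral_gaussianInfo (v : ℝ≥0)
    (hX : Measurable X) (hX2 : MemLp X 2 μ) (hZ : Measurable Z) :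
    Tendsto (fun ε => ENNReal.ofReal (1 / ε ^ 2) *
      ∫⁻ z, gaussianInfo v (condDistrib X Z μ z) ε ∂μ.map Z) (𝓝[>] 0)
      (𝓝 (ENNReal.ofReal (v / 2) * ENNReal.ofReal (avgCondVar μ X Z))) := by
  have hmeas := measurable_gaussianInfo_kernel v (condDistrib X Z μ)
  have hm : Measurable fun z => ∫ t, t ∂condDistrib X Z μ z :=
    (StronglyMeasurable.integral_condDistrib (f := fun q : C × ℝ => q.2)
      measurable_snd.stronglyMeasurable).measurable
  have hV : Measurable fun z => ∫⁻ x, ENNReal.ofReal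
      ((x - ∫ t, t ∂condDistrib X Z μ z) ^ 2) ∂condDistrib X Z μ z :=
    Measurable.lintegral_kernel_prod_right' (f := fun q : C × ℝ =>
      ENNReal.ofReal ((q.2 - ∫ t, t ∂condDistrib X Z μ q.1) ^ 2))
      ((measurable_snd.sub (hm.comp measurable_fst)).pow_const 2).ennreal_ofReal
  rw [← lintegral_condDistrib_sq_sub hX hX2 hZ, ← lintegral_const_mul _ hV]
  simp_rw [← fun ε => lintegral_const_mul (μ := μ.map Z) (ENNReal.ofReal (1 / ε ^ 2)) (hmeas ε)]
  refine tendsto_lintegral_filter_of_dominated_convergence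
    (fun z => ENNReal.ofReal (v / 2) * ∫⁻ x, ENNReal.ofReal
      ((x - ∫ t, t ∂condDistrib X Z μ z) ^ 2) ∂condDistrib X Z μ z)
    (Eventually.of_forall fun ε => (hmeas ε).const_mul _) ?_ ?_ ?_
  · filter_upwards [self_mem_nhdsWithin] with ε hε
    exact ae_of_all _ fun z => ofReal_inv_sq_mul_gaussianInfo_le v _ hε
  · rw [lintegral_const_mul _ hV, lintegral_condDistrib_sq_sub hX hX2 hZ]
    exact ENNReal.mul_ne_top ENNReal.ofReal_ne_top ENNReal.ofReal_ne_top
  · filter_upwards [ae_memLp_condDistrib hX hX2 hZ] with z hz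
    exact tendsto_gaussianInfo v hz

end Conditional

theorem mainTheorem5 {Ω C : Type*} [MeasurableSpace Ω] [MeasurableSpace C]
    (μ : Measure Ω) [IsProbabilityMeasure μ] (K : ℕ)
    (X : Ω → ℝ) (Z : Ω → C) (N : Fin K → Ω → ℝ)
    (hX : Measurable X) (hX2 : MemLp X 2 μ) (hZ : Measurable Z) (hN : ∀ i, Measurable (N i))
    (hN_law : ∀ i, HasLaw (N i) (gaussianReal 0 1) μ)
    (hN_indep : iIndepFun N μ)
    (hXZN : IndepFun (fun ω => (X ω, Z ω)) (fun ω i => N i ω) μ) :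
    Tendsto
      (fun γ : ℝ => ENNReal.ofReal (1 / γ) *
        condMutualInfo μ X (fun ω (i : Fin K) => Real.sqrt γ * X ω + N i ω) Z)
      (𝓝[>] 0)
      (𝓝 (ENNReal.ofReal (K * Real.logb 2 (Real.exp 1) / 2 * avgCondVar μ X Z))) := by
  have hlog : 0 < Real.log 2 := Real.log_pos one_lt_two
  have hsqrt : Tendsto Real.sqrt (𝓝[>] 0) (𝓝[>] 0) := by
    refine tendsto_nhdsWithin_iff.2 ⟨?_, ?_⟩
    · have := Real.continuous_sqrt.tendsto 0
      rw [Real.sqrt_zero] at this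
      exact this.mono_left nhdsWithin_le_nhds
    · filter_upwards [self_mem_nhdsWithin] with γ hγ using Real.sqrt_pos.2 hγ
  have h := ENNReal.Tendsto.div_const
    ((tendsto_lintegral_gaussianInfo (Fintype.card (Fin K)) hX hX2 hZ).comp hsqrt)
    (b := ENNReal.ofReal (Real.log 2)) (Or.inr (ENNReal.ofReal_pos.2 hlog).ne')
  -- Here log₂ e = 1 / log 2 converts nats to bits.
  have hlim : ENNReal.ofReal (K * Real.logb 2 (Real.exp 1) / 2 * avgCondVar μ X Z) =
      ENNReal.ofReal (((Fintype.card (Fin K) : ℝ≥0) : ℝ) / 2) * ENNReal.ofReal (avgCondVar μ X Z) /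
        ENNReal.ofReal (Real.log 2) := by
    rw [← ENNReal.ofReal_mul (by positivity), ← ENNReal.ofReal_div_of_pos hlog, Real.logb,
      Real.log_exp]
    congr 1
    simp
    ring
  rw [hlim]
  refine h.congr' ?_
  filter_upwards [self_mem_nhdsWithin] with γ hγ
  rw [condMutualInfo_gaussianChannel hX hZ hN hN_law hN_indep hXZN, Function.comp_apply,
    Real.sq_sqrt (le_of_lt hγ), mul_div_assoc]
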